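/- Let $\mathbb H$ be the complex upper half plane, let $j:\mathbb H\to\mathbb C$ be the modular $j$-function (holomorphic, $\mathrm{SL}_2(\mathbb Z)$-invariant, with $q$-expansion $j(z)=q^{-1}+744+\sum_{k\ge 1}a_kq^k$, $q=e^{2\pi i z}$; equivalently $j=E_4^3/\Delta$), and let $j'=\mathrm dj/\mathrm dz$. Say that a meromorphic function $f$ on $\mathbb H$ has *order* $(e,d)\in\mathbb Z^2$ *at* $i\infty$ if there are $\alpha\in\mathbb C\setminus\{0\}$ and $C\in\mathbb R$ with $f(w)\sim\alpha w^{-d}e^{2\pi i e w}$ as $w\to\infty$ in the region $\operatorname{Im}(w)\ge C\log|w|$ of $\mathbb H$, and that $f$ has *exponential growth at* $i\infty$ if it has some order $(e,d)$ there with $e<0$. Let $\mathbb F$ be the standard fundamental domain of $\mathrm{SL}_2(\mathbb Z)$; for $\gamma\in\mathrm{SL}_2(\mathbb Z)$, say that $f$ has *exponential growth in the fundamental domain* $\gamma\mathbb F$ if $w\mapsto f(\gamma w)$ has exponential growth at $i\infty$. **Corollary 6.8.** Let $p\in\mathbb C[Y_0,Y_1]$, let $h\in\mathbb C[Y_0]$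 be non-zero, and let $\ell\ge 0$ be an integer with $\ell\ge\deg_{Y_1}(p)$. If the meromorphic function $$P(z)=\frac{p(j(z),j'(z))}{h(j(z))\,j'(z)^\ell}$$ on $\mathbb H$ is non-constant, then $P$ has a pole in $\mathbb H$, or $P$ has exponential growth in $\gamma\mathbb F$ for some $\gamma\in\mathrm{SL}_2(\mathbb Z)$. -/

import Mathlib

open Filter Asymptotics
open scoped MatrixGroups

/-- The modular `j`-function `j = E₄ ^ 3 / Δ` on the upper half plane, where `E₄` is the normalised
Eisenstein series of weight `4` (constant term `1`) and `Δ = q ∏ (1 - q ^ n) ^ 24`.  It is the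
holomorphic `SL(2, ℤ)`-invariant function with `q`-expansion `q⁻¹ + 744 + ∑_{k ≥ 1} a_k q ^ k`. -/
noncomputable def modularJ (z : UpperHalfPlane) : ℂ :=
  (ModularForm.E₄ z) ^ 3 / ModularForm.discriminant z

/-- The complex derivative `j' = dj/dz` on the upper half plane. -/
noncomputable def modularJ' (z : UpperHalfPlane) : ℂ :=
  deriv (modularJ ∘ UpperHalfPlane.ofComplex) (z : ℂ)

/-- `f : ℍ → ℂ` has a pole in `ℍ`: its order at some point of `ℍ` is negative.  This order does not
depend on the value assigned to `f` at the point. -/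
def HasPoleInH (f : UpperHalfPlane → ℂ) : Prop :=
  ∃ τ : UpperHalfPlane, meromorphicOrderAt (f ∘ UpperHalfPlane.ofComplex) (τ : ℂ) < 0

/-- The filter of `w → ∞` within the region `Im w ≥ C log |w|` of the upper half plane. -/
noncomputable def toIInfty (C : ℝ) : Filter UpperHalfPlane :=
  comap (fun w : UpperHalfPlane => (w : ℂ)) (cocompact ℂ) ⊓
    𝓟 {w : UpperHalfPlane | C * Real.log ‖(w : ℂ)‖ ≤ w.im}

/-- `f` has order `(e, d)` at `i∞`: for some `α ≠ 0` and some real `C`,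
`f w ~ α w ^ (-d) exp (2 π i e w)` as `w → ∞` in the region `Im w ≥ C log |w|`. -/
def HasOrderAtIInfty (f : UpperHalfPlane → ℂ) (e d : ℤ) : Prop :=
  ∃ α : ℂ, α ≠ 0 ∧ ∃ C : ℝ,
    f ~[toIInfty C] fun w : UpperHalfPlane =>
      α * (w : ℂ) ^ (-d) * Complex.exp (2 * Real.pi * Complex.I * e * w)

/-- `f` has exponential growth at `i∞`: its order there is some `(e, d)` with `e < 0`. -/
def HasExpGrowthAtIInfty (f : UpperHalfPlane → ℂ) : Prop :=
  ∃ e d : ℤ, e < 0 ∧ HasOrderAtIInfty f e d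

/-- `f` has exponential growth in the fundamental domain `γ 𝔽`, where `𝔽` is the standard
fundamental domain of `SL(2, ℤ)`: the function `w ↦ f (γ w)`, which describes `f` on `γ 𝔽` as `w`
runs through `𝔽`, has exponential growth at `i∞`. -/
def HasExpGrowthIn (f : UpperHalfPlane → ℂ) (γ : SL(2, ℤ)) : Prop :=
  HasExpGrowthAtIInfty fun w => f (γ • w)

/-- The function `p(j, j') / (h(j) j' ^ ℓ)` on the upper half plane; the variables of `p` are
`Y₀ = X 0` and `Y₁ = X 1`. -/
noncomputable def jQuotient (p : MvPolynomial (Fin 2) ℂ) (h : Polynomial ℂ) (ℓ : ℕ)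
    (z : UpperHalfPlane) : ℂ :=
  MvPolynomial.eval ![modularJ z, modularJ' z] p / (h.eval (modularJ z) * modularJ' z ^ ℓ)

/-!
Writing `p` by powers of `Y₁`, the quotient `P` is a sum `∑ F m` over `m ≤ ℓ`, where
`F m = a m (j) / (h(j) j' ^ m)`. Since `j` is `SL(2, ℤ)`-invariant and `j'` has weight `2`, the
component `F m` is meromorphic of weight `-2 m`, so that
`P (γ z) = ∑ F m z (c z + d) ^ (-2 m)` for `γ = (a, b; c, d)`.

Suppose that `P` has no pole. For fixed `z` the matrices with `(c, d) = (1, n)`, `0 ≤ n ≤ ℓ`, give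
`ℓ + 1` values of a polynomial with coefficients `F m z` at distinct points, and inverting a
Vandermonde matrix shows that no `F m` has a pole (`exists_tendsto_jComponent`).

At `i∞` one has `j ~ q⁻¹` and `j' ~ -2 π i q⁻¹`, so each `F m ≠ 0` is asymptotic to a nonzero
multiple of some `q ^ e m`. In the region `Im w ≥ C log |w|` with `C` large, every power of `q`
beats the powers of `w`; hence if some `e m` is negative, then `P (-1 / w) = ∑ F m w * w ^ (-2 m)`
is dominated by the term for which `(e m, m)` is lexicographically least, and grows exponentially
(`hasExpGrowthAtIInfty_of_sum`). So if `P` does not grow exponentially in the domain `S 𝔽`, then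
every `F m` is also regular at the cusp.

Then every `F m` extends to a modular form of level one and weight `-2 m ≤ 0`, hence is constant
(`jComponent_eq_const`), and so is `P`.
-/

open UpperHalfPlane ModularForm Derivative
open scoped Topology Manifold

/-! ### The `j`-function and its derivative -/

lemma mdifferentiable_modularJ : MDiff modularJ := by
  have h4 : MDiff (fun z : ℍ => E₄ z ^ 3) := (E₄.pow 3).holo'
  exact h4.div CuspForm.discriminant.holo' discriminant_ne_zero

lemma modularJ'_eq_normalizedDeriv (z : ℍ) :
    modularJ' z = 2 * Real.pi * Complex.I * normalizedDerivOfComplex modularJ z := by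
  have : (2 * Real.pi * Complex.I : ℂ) ≠ 0 := Complex.two_pi_I_ne_zero
  rw [modularJ', normalizedDerivOfComplex, mul_inv_cancel_left₀ this]

lemma mdifferentiable_modularJ' : MDiff modularJ' := by
  have h := normalizedDerivOfComplex_mdifferentiable mdifferentiable_modularJ
  rw [funext modularJ'_eq_normalizedDeriv]
  exact mdifferentiable_const.mul h

lemma modularJ_smul (γ : SL(2, ℤ)) (z : ℍ) : modularJ (γ • z) = modularJ z := by
  have hγ : (γ : GL (Fin 2) ℝ) ∈ 𝒮ℒ := ⟨γ, rfl⟩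
  have h4 := congrFun (SlashInvariantFormClass.slash_action_eq E₄ _ hγ) z
  have hD := congrFun (SlashInvariantFormClass.slash_action_eq CuspForm.discriminant _ hγ) z
  have hd := denom_ne_zero (γ : GL (Fin 2) ℝ) z
  have hΔ := discriminant_ne_zero (γ • z)
  rw [← SL_slash, SL_slash_apply] at h4 hD
  rw [CuspForm.coe_discriminant] at hD
  rw [modularJ, modularJ, ← h4, ← hD]
  simp only [zpow_neg, zpow_ofNat]
  field_simp

lemma modularJ'_smul (γ : SL(2, ℤ)) (z : ℍ) :
    modularJ' (γ • z) = denom γ z ^ 2 * modularJ' z := by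
  have hJ : modularJ ∣[(0 : ℤ)] γ = modularJ := by
    ext z
    rw [SL_slash_apply, modularJ_smul]
    simp
  have h := congrFun
    (normalizedDerivOfComplex_SL_slash (k := 0) (γ := γ) mdifferentiable_modularJ) z
  have hd := denom_ne_zero (γ : GL (Fin 2) ℝ) z
  rw [hJ] at h
  simp only [Pi.sub_apply, Int.cast_zero, zero_mul, sub_zero, zero_add, SL_slash_apply, zpow_neg,
    zpow_ofNat] at h
  rw [modularJ'_eq_normalizedDeriv, modularJ'_eq_normalizedDeriv, h]
  field_simp

/-! ### Asymptotics at the cusp -/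

/-- Cauchy's estimate on discs of radius `1`: the derivative of a holomorphic function that has a
limit at `i∞` tends to `0` there. -/
lemma tendsto_normalizedDeriv_atImInfty {f : ℍ → ℂ} (hf : MDiff f) {c : ℂ}
    (hc : Tendsto f atImInfty (𝓝 c)) :
    Tendsto (normalizedDerivOfComplex f) atImInfty (𝓝 0) := by
  have key : Tendsto (fun z : ℍ => deriv (f ∘ ofComplex) z) atImInfty (𝓝 0) := by
    rw [Metric.tendsto_nhds]
    intro ε hε
    have h1 := (Metric.tendsto_nhds.mp hc) (ε / 2) (half_pos hε)
    obtain ⟨A, hA⟩ := (atImInfty_mem _).mp h1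
    refine (atImInfty_mem _).mpr ⟨max A 0 + 2, fun z hz => ?_⟩
    have him : ∀ w ∈ Metric.closedBall (z : ℂ) 1, max A 0 + 1 ≤ w.im := by
      intro w hw
      have h2 : |(w - z).im| ≤ 1 :=
        (Complex.abs_im_le_norm _).trans (by simpa [dist_eq_norm] using hw)
      rw [Complex.sub_im, abs_le] at h2
      have := z.coe_im
      linarith [h2.1]
    have hpos : ∀ w ∈ Metric.closedBall (z : ℂ) 1, 0 < w.im := fun w hw => by
      linarith [him w hw, le_max_right A 0]
    have hdiff : DifferentiableOn ℂ (fun w => (f ∘ ofComplex) w - c)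
        (Metric.closedBall (z : ℂ) 1) :=
      (((UpperHalfPlane.mdifferentiable_iff).mp hf).sub_const c).mono hpos
    have hbound := Complex.norm_deriv_le_of_forall_mem_sphere_norm_le (C := ε / 2) one_pos
      (hdiff.diffContOnCl_ball subset_rfl) (fun w hw => by
        have hw' := Metric.sphere_subset_closedBall hw
        have h3 := hA ⟨w, hpos w hw'⟩ (by
          have := him w hw'
          change A ≤ w.im
          linarith [le_max_left A 0])
        simp only [Function.comp_apply, ofComplex_apply_of_im_pos (hpos w hw')]
        rw [← dist_eq_norm]
        exact le_of_lt h3)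
    rw [deriv_sub_const] at hbound
    rw [Set.mem_ofPred_eq, dist_zero_right]
    linarith
  have := key.const_mul ((2 * Real.pi * Complex.I : ℂ)⁻¹)
  rw [mul_zero] at this
  exact this

/-- The nome `q = exp (2 π i z)`. -/
noncomputable def nome (z : ℍ) : ℂ := Complex.exp (2 * Real.pi * Complex.I * z)

lemma nome_ne_zero (z : ℍ) : nome z ≠ 0 := Complex.exp_ne_zero _

lemma norm_nome (z : ℍ) : ‖nome z‖ = Real.exp (-(2 * Real.pi * z.im)) := by
  simp [nome, Complex.norm_exp]

lemma nome_zpow (z : ℍ) (e : ℤ) :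
    nome z ^ e = Complex.exp (2 * Real.pi * Complex.I * e * z) := by
  rw [nome, ← Complex.exp_int_mul]
  ring_nf

lemma hasDerivAt_nome (z : ℍ) :
    HasDerivAt (nome ∘ ofComplex) (2 * Real.pi * Complex.I * nome z) (z : ℂ) := by
  have h1 : HasDerivAt (fun w : ℂ => Complex.exp (2 * Real.pi * Complex.I * w))
      (2 * Real.pi * Complex.I * nome z) (z : ℂ) := by
    have := ((hasDerivAt_id (z : ℂ)).const_mul (2 * Real.pi * Complex.I : ℂ)).cexp
    simpa [nome, mul_comm] using this
  refine h1.congr_of_eventuallyEq ?_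
  filter_upwards [isOpen_upperHalfPlaneSet.mem_nhds z.im_pos] with w hw
  simp [nome, ofComplex_apply_of_im_pos hw]

lemma mdifferentiable_nome : MDiff nome := fun z =>
  mdifferentiableAt_iff.mpr (hasDerivAt_nome z).differentiableAt

lemma normalizedDeriv_nome : normalizedDerivOfComplex nome = nome := by
  ext z
  rw [normalizedDerivOfComplex, (hasDerivAt_nome z).deriv,
    inv_mul_cancel_left₀ Complex.two_pi_I_ne_zero]

lemma tendsto_nome : Tendsto nome atImInfty (𝓝 0) := by
  refine (qParam_tendsto_atImInfty one_pos).congr fun z => ?_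
  simp [nome, Function.Periodic.qParam]

lemma tendsto_E₄_atImInfty : Tendsto E₄ atImInfty (𝓝 1) := by
  have han := ModularFormClass.analyticAt_cuspFunction_zero E₄ one_pos one_mem_strictPeriods_SL
  have h0 : cuspFunction 1 E₄ 0 = 1 := by
    have := EisensteinSeries.E_qExpansion_coeff_zero (k := 4) (by norm_num) ⟨2, rfl⟩
    simpa [qExpansion_coeff] using this
  have := han.continuousAt.tendsto.comp (qParam_tendsto_atImInfty one_pos)
  rw [h0] at this
  exact this.congr fun τ =>
    SlashInvariantFormClass.eq_cuspFunction E₄ τ one_mem_strictPeriods_SL one_ne_zero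

lemma tendsto_discriminant_div_nome :
    Tendsto (fun z => discriminant z / nome z) atImInfty (𝓝 1) := by
  refine tendsto_atImInfty_tprod_one_sub_eta_q_pow.congr fun z => ?_
  have : nome z = Function.Periodic.qParam 1 z := by simp [nome, Function.Periodic.qParam]
  rw [discriminant_eq_q_prod, ← this, mul_div_cancel_left₀ _ (nome_ne_zero z)]

/-- The `q`-expansion of `j` begins with `q⁻¹`. -/
lemma tendsto_modularJ_mul_nome : Tendsto (modularJ * nome) atImInfty (𝓝 1) := by
  have := (tendsto_E₄_atImInfty.pow 3).div tendsto_discriminant_div_nome one_ne_zero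
  rw [one_pow, div_one] at this
  refine this.congr fun z => ?_
  have h1 := discriminant_ne_zero z
  have h2 := nome_ne_zero z
  simp only [Pi.mul_apply, modularJ, Pi.div_apply]
  field_simp

/-- The `q`-expansion of `j'` begins with `-2 π i q⁻¹`: differentiating `j q → 1` gives
`(2 π i)⁻¹ j' q + j q → 0`. -/
lemma tendsto_modularJ'_mul_nome :
    Tendsto (modularJ' * nome) atImInfty (𝓝 (-(2 * Real.pi * Complex.I))) := by
  have h := tendsto_normalizedDeriv_atImInfty (mdifferentiable_modularJ.mul mdifferentiable_nome)
    tendsto_modularJ_mul_nome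
  rw [normalizedDerivOfComplex_mul _ _ mdifferentiable_modularJ mdifferentiable_nome,
    normalizedDeriv_nome] at h
  have := (h.sub tendsto_modularJ_mul_nome).const_mul (2 * Real.pi * Complex.I : ℂ)
  rw [zero_sub, mul_neg, mul_one] at this
  refine this.congr fun z => ?_
  simp only [Pi.mul_apply, Pi.add_apply, modularJ'_eq_normalizedDeriv]
  ring

/-- `a (j) ~ (leading coefficient of a) q ^ (-deg a)` at `i∞`. -/
lemma tendsto_eval_modularJ_mul_nome (a : Polynomial ℂ) :
    Tendsto (fun z => a.eval (modularJ z) * nome z ^ a.natDegree) atImInfty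
      (𝓝 a.leadingCoeff) := by
  have hterm : ∀ i ∈ Finset.range (a.natDegree + 1),
      Tendsto (fun z => a.coeff i * (modularJ z * nome z) ^ i * nome z ^ (a.natDegree - i))
        atImInfty (𝓝 (if i = a.natDegree then a.leadingCoeff else 0)) := by
    intro i hi
    have h1 := ((tendsto_modularJ_mul_nome.pow i).const_mul (a.coeff i)).mul
      (tendsto_nome.pow (a.natDegree - i))
    have hi' : i ≤ a.natDegree := Nat.lt_succ_iff.mp (Finset.mem_range.mp hi)
    split_ifs with h
    · subst h
      simpa using h1
    · rw [zero_pow (by omega), mul_zero] at h1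
      exact h1
  have hsum := tendsto_finsetSum _ hterm
  simp only [Finset.sum_ite_eq', Finset.mem_range, Nat.lt_succ_self, if_true] at hsum
  refine hsum.congr fun z => ?_
  rw [Polynomial.eval_eq_sum_range, Finset.sum_mul]
  refine Finset.sum_congr rfl fun i hi => ?_
  have hi' : i ≤ a.natDegree := Nat.lt_succ_iff.mp (Finset.mem_range.mp hi)
  rw [← Nat.add_sub_cancel' hi', pow_add, Nat.add_sub_cancel' hi']
  ring

lemma eventually_eval_modularJ_ne_zero {a : Polynomial ℂ} (ha : a ≠ 0) :
    ∀ᶠ z in atImInfty, a.eval (modularJ z) ≠ 0 := by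
  filter_upwards [(tendsto_eval_modularJ_mul_nome a).eventually_ne
    (Polynomial.leadingCoeff_ne_zero.mpr ha)] with z hz
  exact left_ne_zero_of_mul hz

lemma eventually_modularJ'_ne_zero : ∀ᶠ z in atImInfty, modularJ' z ≠ 0 := by
  filter_upwards [tendsto_modularJ'_mul_nome.eventually_ne
    (neg_ne_zero.mpr Complex.two_pi_I_ne_zero)] with z hz
  exact left_ne_zero_of_mul hz

/-! ### Growth along the region `Im w ≥ C log |w|` -/

lemma tendsto_norm_toIInfty (C : ℝ) :
    Tendsto (fun w : ℍ => ‖(w : ℂ)‖) (toIInfty C) atTop :=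
  tendsto_norm_cocompact_atTop.comp (tendsto_comap.mono_left inf_le_left)

lemma eventually_mul_log_le_im (C : ℝ) :
    ∀ᶠ w : ℍ in toIInfty C, C * Real.log ‖(w : ℂ)‖ ≤ w.im :=
  mem_inf_of_right (mem_principal_self _)

lemma toIInfty_le_atImInfty {C : ℝ} (hC : 0 < C) : toIInfty C ≤ atImInfty := by
  have him : Tendsto im (toIInfty C) atTop :=
    tendsto_atTop_mono' _ (eventually_mul_log_le_im C)
      ((Real.tendsto_log_atTop.comp (tendsto_norm_toIInfty C)).const_mul_atTop hC)
  exact tendsto_iff_comap.mp him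

lemma tendsto_inv_sq_toIInfty (C : ℝ) :
    Tendsto (fun w : ℍ => ((w : ℂ) ^ 2)⁻¹) (toIInfty C) (𝓝 0) := by
  rw [tendsto_zero_iff_norm_tendsto_zero]
  simp only [norm_inv, norm_pow]
  exact ((tendsto_pow_atTop two_ne_zero).comp (tendsto_norm_toIInfty C)).inv_tendsto_atTop

/-- In the region `Im w ≥ (n + 1) log |w|` the nome decays faster than `|w| ^ (-n)`. -/
lemma tendsto_nome_mul_pow_toIInfty (n : ℕ) :
    Tendsto (fun w : ℍ => nome w * (w : ℂ) ^ n) (toIInfty (n + 1)) (𝓝 0) := by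
  have hinv := (tendsto_norm_toIInfty (n + 1)).inv_tendsto_atTop
  refine squeeze_zero_norm' ?_ hinv
  filter_upwards [eventually_mul_log_le_im (n + 1),
    (tendsto_norm_toIInfty (n + 1)).eventually_ge_atTop 1] with w hw h1
  have h0 : 0 < ‖(w : ℂ)‖ := by linarith
  have hpi : w.im ≤ 2 * Real.pi * w.im :=
    le_mul_of_one_le_left w.im_pos.le (by linarith [Real.pi_gt_three])
  rw [norm_mul, norm_nome, norm_pow, Pi.inv_apply, ← Real.exp_log h0, ← Real.exp_nat_mul,
    ← Real.exp_add, ← Real.exp_neg, Real.exp_le_exp]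
  linarith

/-- A finite sum of functions `F m` behaving like `α m * q ^ e m` at `i∞`, weighted by the powers
`w ^ (-2 m)`, has exponential growth as soon as one of the exponents `e m` is negative: the
dominant term is the one for which `(e m, m)` is lexicographically smallest. -/
lemma hasExpGrowthAtIInfty_of_sum {g : ℍ → ℂ} {s : Finset ℕ} {F : ℕ → ℍ → ℂ} {e : ℕ → ℤ}
    {α : ℕ → ℂ} (hα : ∀ m ∈ s, α m ≠ 0)
    (hF : ∀ m ∈ s, Tendsto (fun z => F m z * nome z ^ (-e m)) atImInfty (𝓝 (α m)))
    (hg : ∀ᶠ w in atImInfty, g w = ∑ m ∈ s, F m w * ((w : ℂ) ^ 2)⁻¹ ^ m)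
    (hneg : ∃ m ∈ s, e m < 0) : HasExpGrowthAtIInfty g := by
  obtain ⟨m₁, hm₁, hem₁⟩ := hneg
  obtain ⟨m₀, hm₀, hmin⟩ := s.exists_min_image (fun m => toLex (e m, m)) ⟨m₁, hm₁⟩
  simp only [Prod.Lex.le_iff, ofLex_toLex] at hmin
  have he₀ : e m₀ < 0 := by
    rcases hmin m₁ hm₁ with h | h <;> omega
  refine ⟨e m₀, (2 * m₀ : ℕ), he₀, α m₀, hα m₀ hm₀, (2 * m₀ : ℕ) + 1, ?_⟩
  have hle : toIInfty ((2 * m₀ : ℕ) + 1) ≤ atImInfty := toIInfty_le_atImInfty (by positivity)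
  have hinv := tendsto_inv_sq_toIInfty ((2 * m₀ : ℕ) + 1)
  have hterm : ∀ m ∈ s, Tendsto
      (fun w : ℍ => F m w * ((w : ℂ) ^ 2)⁻¹ ^ m * ((w : ℂ) ^ (2 * m₀) * nome w ^ (-e m₀)))
      (toIInfty ((2 * m₀ : ℕ) + 1)) (𝓝 (if m = m₀ then α m₀ else 0)) := by
    intro m hm
    have hFm := (hF m hm).mono_left hle
    rcases hmin m hm with hlt | ⟨heq, hmle⟩
    · -- `q ^ (e m - e m₀)` contains a factor `q`, which absorbs `w ^ (2 m₀)`.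
      obtain ⟨k, hk⟩ : ∃ k : ℕ, e m = e m₀ + 1 + k := ⟨(e m - e m₀ - 1).toNat, by omega⟩
      have h := ((hFm.mul (tendsto_nome_mul_pow_toIInfty (2 * m₀))).mul
        ((tendsto_nome.mono_left hle).pow k)).mul (hinv.pow m)
      rw [mul_zero, zero_mul, zero_mul] at h
      rw [if_neg (by rintro rfl; exact lt_irrefl _ hlt)]
      refine h.congr fun w => ?_
      have hq : nome w ^ (-e m₀) = nome w ^ (-e m) * nome w * nome w ^ k := by
        rw [← zpow_natCast, ← zpow_add_one₀ (nome_ne_zero w), ← zpow_add₀ (nome_ne_zero w), hk]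
        congr 1
        ring
      rw [hq]
      ring
    · -- The exponential factors agree, and `w ^ (-2 (m - m₀))` decays unless `m = m₀`.
      have h := hFm.mul (hinv.pow (m - m₀))
      have hlim : α m * 0 ^ (m - m₀) = if m = m₀ then α m₀ else 0 := by
        split_ifs with hmm
        · simp [hmm]
        · rw [zero_pow (by omega), mul_zero]
      rw [hlim] at h
      refine h.congr fun w => ?_
      have hw := w.ne_zero
      obtain ⟨k, rfl⟩ : ∃ k, m = m₀ + k := ⟨m - m₀, by omega⟩
      rw [heq, Nat.add_sub_cancel_left, pow_add, pow_mul, inv_pow ((w : ℂ) ^ 2) m₀]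
      field_simp
  have hsum := (tendsto_finsetSum s hterm).div_const (α m₀)
  simp only [Finset.sum_ite_eq', hm₀, if_true, div_self (hα m₀ hm₀)] at hsum
  refine isEquivalent_of_tendsto_one (hsum.congr' ?_)
  filter_upwards [hle hg] with w hw
  have hw0 := w.ne_zero
  have hq0 := nome_ne_zero w
  rw [Pi.div_apply, hw, ← nome_zpow, ← Finset.sum_mul]
  simp only [zpow_neg, zpow_natCast]
  field_simp

/-! ### Removable singularities -/

lemma map_coe_nhdsNE (τ : ℍ) : map ((↑) : ℍ → ℂ) (𝓝[≠] τ) = 𝓝[≠] (τ : ℂ) := by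
  have hinj : Function.Injective ((↑) : ℍ → ℂ) := isEmbedding_coe.injective
  rw [isEmbedding_coe.map_nhdsWithin_eq, Set.image_compl_eq_range_sdiff_image hinj,
    Set.image_singleton, Set.sdiff_eq, nhdsWithin_inter_of_mem]
  exact mem_nhdsWithin_of_mem_nhds (isOpenEmbedding_coe.isOpen_range.mem_nhds ⟨τ, rfl⟩)

lemma eventually_nhdsNE_coe {τ : ℍ} {P : ℂ → Prop} :
    (∀ᶠ z in 𝓝[≠] (τ : ℂ), P z) ↔ ∀ᶠ z : ℍ in 𝓝[≠] τ, P z := by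
  rw [← map_coe_nhdsNE, eventually_map]

lemma tendsto_comp_ofComplex_nhdsNE_iff {f : ℍ → ℂ} {τ : ℍ} {l : Filter ℂ} :
    Tendsto (f ∘ ofComplex) (𝓝[≠] (τ : ℂ)) l ↔ Tendsto f (𝓝[≠] τ) l := by
  rw [← map_coe_nhdsNE, tendsto_map'_iff]
  have : (f ∘ ofComplex) ∘ ((↑) : ℍ → ℂ) = f := by
    ext z
    simp
  rw [this]

instance neBot_nhdsNE (τ : ℍ) : (𝓝[≠] τ).NeBot := by
  rw [← map_neBot_iff ((↑) : ℍ → ℂ), map_coe_nhdsNE]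
  infer_instance

lemma tendsto_smul_nhdsNE (γ : SL(2, ℤ)) (τ : ℍ) :
    Tendsto (fun z : ℍ => γ • z) (𝓝[≠] τ) (𝓝[≠] (γ • τ)) :=
  (continuous_const_smul (γ : GL (Fin 2) ℝ)).continuousAt.continuousWithinAt.tendsto_nhdsWithin
    fun _ hz => (MulAction.injective γ).ne hz

lemma eq_of_eventuallyEq_nhdsNE {f g : ℍ → ℂ} {τ : ℍ} (hf : ContinuousAt f τ)
    (hg : ContinuousAt g τ) (h : f =ᶠ[𝓝[≠] τ] g) : f τ = g τ :=
  ((hf.eventuallyEq_nhds_iff_eventuallyEq_nhdsNE hg).mp h).eq_of_nhds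

/-- A meromorphic function on `ℍ` which has a finite limit at every point extends holomorphically
over its singularities. -/
lemma exists_mdifferentiable_eventuallyEq {f : ℍ → ℂ}
    (hf : ∀ τ : ℍ, MeromorphicAt (f ∘ ofComplex) τ)
    (hlim : ∀ τ : ℍ, ∃ c, Tendsto f (𝓝[≠] τ) (𝓝 c)) :
    ∃ g : ℍ → ℂ, MDiff g ∧ ∀ τ, g =ᶠ[𝓝[≠] τ] f := by
  have hU : MeromorphicOn (f ∘ ofComplex) upperHalfPlaneSet := fun z hz => hf ⟨z, hz⟩
  set G := toMeromorphicNFOn (f ∘ ofComplex) upperHalfPlaneSet with hG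
  refine ⟨fun z => G z, fun τ => ?_, fun τ => ?_⟩
  · have hord : 0 ≤ meromorphicOrderAt G τ := by
      rw [hG, meromorphicOrderAt_toMeromorphicNFOn hU τ.im_pos,
        ← tendsto_nhds_iff_meromorphicOrderAt_nonneg (hf τ)]
      simpa only [tendsto_comp_ofComplex_nhdsNE_iff] using hlim τ
    have hNF := meromorphicNFOn_toMeromorphicNFOn (f ∘ ofComplex) upperHalfPlaneSet τ.im_pos
    have han := hNF.meromorphicOrderAt_nonneg_iff_analyticAt.mp hord
    refine mdifferentiableAt_iff.mpr (han.differentiableAt.congr_of_eventuallyEq ?_)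
    filter_upwards [isOpen_upperHalfPlaneSet.mem_nhds τ.im_pos] with w hw
    simp [ofComplex_apply_of_im_pos hw, hG]
  · have := eventually_nhdsNE_coe.mp (hU.toMeromorphicNFOn_eq_self_on_nhdsNE τ.im_pos)
    filter_upwards [this] with z hz
    simpa using hz

/-- If the values of a polynomial with varying coefficients `x k` converge at as many varying
points `y i`, with distinct limits, as there are coefficients, then the coefficients converge:
invert the Vandermonde matrix. -/
lemma tendsto_coeff_of_tendsto_sum_pow {ι : Type*} {l : Filter ι} {n : ℕ} {x y : Fin n → ι → ℂ}
    {y₀ s₀ : Fin n → ℂ} (hy : ∀ i, Tendsto (y i) l (𝓝 (y₀ i))) (hinj : Function.Injective y₀)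
    (hs : ∀ i, Tendsto (fun t => ∑ k, x k t * y i t ^ (k : ℕ)) l (𝓝 (s₀ i))) (k : Fin n) :
    ∃ c, Tendsto (x k) l (𝓝 c) := by
  set V : ι → Matrix (Fin n) (Fin n) ℂ := fun t => Matrix.vandermonde fun i => y i t with hV
  set V₀ := Matrix.vandermonde y₀
  have hVlim : Tendsto V l (𝓝 V₀) :=
    tendsto_pi_nhds.mpr fun i => tendsto_pi_nhds.mpr fun j => (hy i).pow j
  have hdet₀ : V₀.det ≠ 0 := Matrix.det_vandermonde_ne_zero_iff.mpr hinj
  have hdet : ∀ᶠ t in l, (V t).det ≠ 0 :=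
    ((continuous_id.matrix_det.tendsto V₀).comp hVlim).eventually_ne hdet₀
  have hinv : Tendsto (fun t => (V t)⁻¹) l (𝓝 V₀⁻¹) := by
    refine (continuousAt_matrix_inv V₀ ?_).tendsto.comp hVlim
    rw [Ring.inverse_eq_inv']
    exact continuousAt_inv₀ hdet₀
  have hmul : Tendsto (fun t => ∑ i, (V t)⁻¹ k i * ∑ k, x k t * y i t ^ (k : ℕ)) l
      (𝓝 (∑ i, V₀⁻¹ k i * s₀ i)) :=
    tendsto_finsetSum _ fun i _ =>
      ((tendsto_pi_nhds.mp (tendsto_pi_nhds.mp hinv k) i)).mul (hs i)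
  refine ⟨_, hmul.congr' ?_⟩
  filter_upwards [hdet] with t ht
  have h1 : (V t)⁻¹.mulVec ((V t).mulVec fun k => x k t) = fun k => x k t := by
    rw [Matrix.mulVec_mulVec, Matrix.nonsing_inv_mul _ (isUnit_iff_ne_zero.mpr ht),
      Matrix.one_mulVec]
  have h2 := congrFun h1 k
  simp only [Matrix.mulVec, dotProduct] at h2
  rw [← h2]
  refine Finset.sum_congr rfl fun i _ => ?_
  congr 1
  exact Finset.sum_congr rfl fun j _ => mul_comm _ _

/-! ### Decomposition into modular components -/

/-- The function `a(j) / (h(j) j' ^ m)`, which transforms like a modular form of weight `-2 m`. -/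
noncomputable def jComponent (a h : Polynomial ℂ) (m : ℕ) (z : ℍ) : ℂ :=
  a.eval (modularJ z) / (h.eval (modularJ z) * modularJ' z ^ m)

lemma jComponent_smul (a h : Polynomial ℂ) (m : ℕ) (γ : SL(2, ℤ)) (z : ℍ) :
    jComponent a h m (γ • z) = jComponent a h m z * (denom γ z ^ 2)⁻¹ ^ m := by
  rw [jComponent, jComponent, modularJ_smul, modularJ'_smul, mul_pow, inv_pow]
  simp only [div_eq_mul_inv, mul_inv]
  ring

/-- The coefficients of `p` as a polynomial in `Y₁` are polynomials in `Y₀`; they are indexed here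
by the codegree `m`, relative to `ℓ`, of the power of `Y₁`. -/
lemma exists_eval_eq_sum (p : MvPolynomial (Fin 2) ℂ) {ℓ : ℕ}
    (hl : MvPolynomial.degreeOf 1 p ≤ ℓ) :
    ∃ a : ℕ → Polynomial ℂ, ∀ x y : ℂ,
      MvPolynomial.eval ![x, y] p = ∑ m ∈ Finset.range (ℓ + 1), (a m).eval x * y ^ (ℓ - m) := by
  let b : ℕ → Polynomial ℂ := fun k => ∑ s ∈ p.support with s 1 = k,
    Polynomial.C (p.coeff s) * Polynomial.X ^ s 0
  refine ⟨fun m => b (ℓ - m), fun x y => ?_⟩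
  have hmaps : ∀ s ∈ p.support, s 1 ∈ Finset.range (ℓ + 1) := fun s hs =>
    Finset.mem_range.mpr (Nat.lt_succ_iff.mpr
      ((MvPolynomial.degreeOf_le_iff.mp hl) s hs))
  rw [Finset.sum_flip fun k => (b k).eval x * y ^ k, MvPolynomial.eval_eq',
    ← Finset.sum_fiberwise_of_maps_to hmaps]
  refine Finset.sum_congr rfl fun k _ => ?_
  rw [Polynomial.eval_finsetSum, Finset.sum_mul]
  refine Finset.sum_congr rfl fun s hs => ?_
  rw [← (Finset.mem_filter.mp hs).2]
  simp [Fin.prod_univ_two, mul_assoc]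

lemma jQuotient_eq_sum {p : MvPolynomial (Fin 2) ℂ} {h : Polynomial ℂ} {ℓ : ℕ}
    {a : ℕ → Polynomial ℂ}
    (ha : ∀ x y : ℂ, MvPolynomial.eval ![x, y] p =
      ∑ m ∈ Finset.range (ℓ + 1), (a m).eval x * y ^ (ℓ - m))
    {z : ℍ} (hz : h.eval (modularJ z) * modularJ' z ^ ℓ ≠ 0) :
    jQuotient p h ℓ z = ∑ m ∈ Finset.range (ℓ + 1), jComponent (a m) h m z := by
  rw [jQuotient, ha, Finset.sum_div]
  refine Finset.sum_congr rfl fun m hm => ?_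
  obtain ⟨k, rfl⟩ := Nat.exists_eq_add_of_le (Nat.lt_succ_iff.mp (Finset.mem_range.mp hm))
  rw [pow_add, ← mul_assoc] at hz
  rw [Nat.add_sub_cancel_left, jComponent, pow_add, ← mul_assoc,
    mul_div_mul_right _ _ (right_ne_zero_of_mul hz)]

lemma denominator_smul_ne_zero {h : Polynomial ℂ} {ℓ : ℕ} {z : ℍ}
    (hz : h.eval (modularJ z) * modularJ' z ^ ℓ ≠ 0) (γ : SL(2, ℤ)) :
    h.eval (modularJ (γ • z)) * modularJ' (γ • z) ^ ℓ ≠ 0 := by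
  rw [modularJ_smul, modularJ'_smul, mul_pow, mul_left_comm]
  exact mul_ne_zero (pow_ne_zero _ (pow_ne_zero _ (denom_ne_zero (γ : GL (Fin 2) ℝ) z))) hz

lemma jQuotient_smul_eq_sum {p : MvPolynomial (Fin 2) ℂ} {h : Polynomial ℂ} {ℓ : ℕ}
    {a : ℕ → Polynomial ℂ}
    (ha : ∀ x y : ℂ, MvPolynomial.eval ![x, y] p =
      ∑ m ∈ Finset.range (ℓ + 1), (a m).eval x * y ^ (ℓ - m))
    {z : ℍ} (hz : h.eval (modularJ z) * modularJ' z ^ ℓ ≠ 0) (γ : SL(2, ℤ)) :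
    jQuotient p h ℓ (γ • z) =
      ∑ m ∈ Finset.range (ℓ + 1), jComponent (a m) h m z * (denom γ z ^ 2)⁻¹ ^ m := by
  rw [jQuotient_eq_sum ha (denominator_smul_ne_zero hz γ)]
  exact Finset.sum_congr rfl fun m _ => jComponent_smul _ _ _ _ _

lemma mdifferentiable_eval_modularJ (a : Polynomial ℂ) :
    MDiff (fun z => a.eval (modularJ z)) := fun z =>
  mdifferentiableAt_iff.mpr
    (a.differentiable.differentiableAt.comp (z : ℂ)
      (mdifferentiableAt_iff.mp (mdifferentiable_modularJ z)))

lemma mdifferentiable_denominator (h : Polynomial ℂ) (m : ℕ) :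
    MDiff (fun z => h.eval (modularJ z) * modularJ' z ^ m) :=
  (mdifferentiable_eval_modularJ h).mul (mdifferentiable_modularJ'.pow m)

lemma eventually_denominator_ne_zero_atImInfty {h : Polynomial ℂ} (hh : h ≠ 0) (m : ℕ) :
    ∀ᶠ z in atImInfty, h.eval (modularJ z) * modularJ' z ^ m ≠ 0 := by
  filter_upwards [eventually_eval_modularJ_ne_zero hh, eventually_modularJ'_ne_zero] with z h1 h2
  exact mul_ne_zero h1 (pow_ne_zero _ h2)

lemma eventually_denominator_ne_zero {h : Polynomial ℂ} (hh : h ≠ 0) (m : ℕ) (τ : ℍ) :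
    ∀ᶠ z in 𝓝[≠] τ, h.eval (modularJ z) * modularJ' z ^ m ≠ 0 := by
  by_contra hcon
  have hzero := eq_zero_of_frequently (mdifferentiable_denominator h m)
    ((not_eventually.mp hcon).mono fun _ hz => not_not.mp hz)
  obtain ⟨A, hA⟩ := (atImInfty_mem _).mp (eventually_denominator_ne_zero_atImInfty hh m)
  exact hA ⟨(max A 1 : ℝ) * Complex.I, by simp⟩ (by
    change A ≤ Complex.im _
    simp) (congrFun hzero _)

lemma meromorphicAt_of_mdifferentiable {f : ℍ → ℂ} (hf : MDiff f) (τ : ℍ) :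
    MeromorphicAt (f ∘ ofComplex) τ :=
  ((UpperHalfPlane.mdifferentiable_iff.mp hf).analyticAt
    (isOpen_upperHalfPlaneSet.mem_nhds τ.im_pos)).meromorphicAt

lemma meromorphicAt_jComponent (a h : Polynomial ℂ) (m : ℕ) (τ : ℍ) :
    MeromorphicAt (jComponent a h m ∘ ofComplex) τ :=
  (meromorphicAt_of_mdifferentiable (mdifferentiable_eval_modularJ a) τ).div
    (meromorphicAt_of_mdifferentiable (mdifferentiable_denominator h m) τ)

lemma continuousAt_jComponent {a h : Polynomial ℂ} {m : ℕ} {τ : ℍ}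
    (hτ : h.eval (modularJ τ) * modularJ' τ ^ m ≠ 0) : ContinuousAt (jComponent a h m) τ :=
  (mdifferentiable_eval_modularJ a).continuous.continuousAt.div
    (mdifferentiable_denominator h m).continuous.continuousAt hτ

lemma meromorphicAt_jQuotient {p : MvPolynomial (Fin 2) ℂ} {h : Polynomial ℂ} (hh : h ≠ 0) {ℓ : ℕ}
    {a : ℕ → Polynomial ℂ}
    (ha : ∀ x y : ℂ, MvPolynomial.eval ![x, y] p =
      ∑ m ∈ Finset.range (ℓ + 1), (a m).eval x * y ^ (ℓ - m)) (τ : ℍ) :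
    MeromorphicAt (jQuotient p h ℓ ∘ ofComplex) τ := by
  have hsum : MeromorphicAt
      (∑ m ∈ Finset.range (ℓ + 1), jComponent (a m) h m ∘ ofComplex) (τ : ℂ) :=
    MeromorphicAt.sum fun m _ => meromorphicAt_jComponent _ _ _ _
  refine hsum.congr (eventually_nhdsNE_coe.mpr ?_)
  filter_upwards [eventually_denominator_ne_zero hh ℓ τ] with z hz
  simp [jQuotient_eq_sum ha hz]

/-! ### Components of a quotient without poles -/

/-- The element `(0, -1; 1, n)` of `SL(2, ℤ)`, acting by `z ↦ -1 / (z + n)`. -/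
def inversionTranslate (n : ℤ) : SL(2, ℤ) :=
  ⟨!![0, -1; 1, n], by simp [Matrix.det_fin_two]⟩

lemma denom_inversionTranslate (n : ℤ) (z : ℍ) : denom (inversionTranslate n) z = z + n := by
  rw [ModularGroup.denom_apply]
  simp [inversionTranslate]

lemma injective_inv_add_natCast_sq (τ : ℍ) :
    Function.Injective fun n : ℕ => (((τ : ℂ) + n) ^ 2)⁻¹ := by
  intro n k hnk
  have h1 : ((τ : ℂ) + n) ^ 2 = ((τ : ℂ) + k) ^ 2 := inv_injective hnk
  rcases sq_eq_sq_iff_eq_or_eq_neg.mp h1 with h2 | h2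
  · exact_mod_cast add_left_cancel h2
  · have h3 := congrArg Complex.im h2
    simp at h3
    linarith [τ.im_pos]

/-- If `P = jQuotient p h ℓ` has no pole, then neither have its components: the values of `P` at
`-1 / (z + n)`, for `n = 0, …, ℓ`, determine the components at `z`. -/
lemma exists_tendsto_jComponent {p : MvPolynomial (Fin 2) ℂ} {h : Polynomial ℂ} (hh : h ≠ 0)
    {ℓ : ℕ} {a : ℕ → Polynomial ℂ}
    (ha : ∀ x y : ℂ, MvPolynomial.eval ![x, y] p =
      ∑ m ∈ Finset.range (ℓ + 1), (a m).eval x * y ^ (ℓ - m))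
    (hpole : ¬ HasPoleInH (jQuotient p h ℓ)) {m : ℕ} (hm : m ∈ Finset.range (ℓ + 1)) (τ : ℍ) :
    ∃ c, Tendsto (jComponent (a m) h m) (𝓝[≠] τ) (𝓝 c) := by
  have hlim : ∀ σ : ℍ, ∃ c, Tendsto (jQuotient p h ℓ) (𝓝[≠] σ) (𝓝 c) := by
    intro σ
    have hord : 0 ≤ meromorphicOrderAt (jQuotient p h ℓ ∘ ofComplex) σ :=
      not_lt.mp fun hσ => hpole ⟨σ, hσ⟩
    obtain ⟨c, hc⟩ := (tendsto_nhds_iff_meromorphicOrderAt_nonneg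
      (meromorphicAt_jQuotient hh ha σ)).mpr hord
    exact ⟨c, tendsto_comp_ofComplex_nhdsNE_iff.mp hc⟩
  choose s hs using hlim
  have key := tendsto_coeff_of_tendsto_sum_pow (l := 𝓝[≠] τ) (n := ℓ + 1)
    (x := fun k => jComponent (a k) h k) (y := fun i z => (((z : ℂ) + (i : ℕ)) ^ 2)⁻¹)
    (y₀ := fun i => (((τ : ℂ) + (i : ℕ)) ^ 2)⁻¹)
    (s₀ := fun i => s (inversionTranslate (i : ℕ) • τ)) (fun i => ?_)
    (fun i j hij => Fin.ext (injective_inv_add_natCast_sq τ hij)) (fun i => ?_)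
    ⟨m, Finset.mem_range.mp hm⟩
  · exact key
  · have hne : ((τ : ℂ) + (i : ℕ)) ^ 2 ≠ 0 := by
      have := denom_ne_zero (inversionTranslate (i : ℕ) : GL (Fin 2) ℝ) τ
      rw [denom_inversionTranslate] at this
      exact pow_ne_zero 2 (by simpa using this)
    have hcont : ContinuousAt (fun z : ℍ => (((z : ℂ) + (i : ℕ)) ^ 2)⁻¹) τ :=
      ((continuous_coe.add continuous_const).pow 2).continuousAt.inv₀ hne
    exact hcont.tendsto.mono_left nhdsWithin_le_nhds
  · refine ((hs _).comp (tendsto_smul_nhdsNE (inversionTranslate (i : ℕ)) τ)).congr' ?_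
    filter_upwards [eventually_denominator_ne_zero hh ℓ τ] with z hz
    rw [Function.comp_apply, jQuotient_smul_eq_sum ha hz, denom_inversionTranslate,
      ← Fin.sum_univ_eq_sum_range
        (fun m => jComponent (a m) h m z * (((z : ℂ) + ((i : ℕ) : ℤ)) ^ 2)⁻¹ ^ m)]
    simp

/-! ### Components at the cusp -/

/-- The exponent of the leading power of `q` in `a(j) / (h(j) j' ^ m)`, for `a ≠ 0`. -/
def jComponentOrder (a h : Polynomial ℂ) (m : ℕ) : ℤ :=
  m + h.natDegree - a.natDegree

/-- The coefficient of the leading power of `q` in `a(j) / (h(j) j' ^ m)`. -/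
noncomputable def jComponentCoeff (a h : Polynomial ℂ) (m : ℕ) : ℂ :=
  a.leadingCoeff / (h.leadingCoeff * (-(2 * Real.pi * Complex.I)) ^ m)

lemma jComponentCoeff_ne_zero {a h : Polynomial ℂ} (ha : a ≠ 0) (hh : h ≠ 0) (m : ℕ) :
    jComponentCoeff a h m ≠ 0 :=
  div_ne_zero (Polynomial.leadingCoeff_ne_zero.mpr ha)
    (mul_ne_zero (Polynomial.leadingCoeff_ne_zero.mpr hh)
      (pow_ne_zero _ (neg_ne_zero.mpr Complex.two_pi_I_ne_zero)))

lemma tendsto_jComponent_mul_nome (a : Polynomial ℂ) {h : Polynomial ℂ} (hh : h ≠ 0) (m : ℕ) :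
    Tendsto (fun z => jComponent a h m z * nome z ^ (-jComponentOrder a h m)) atImInfty
      (𝓝 (jComponentCoeff a h m)) := by
  have hden : h.leadingCoeff * (-(2 * Real.pi * Complex.I : ℂ)) ^ m ≠ 0 :=
    mul_ne_zero (Polynomial.leadingCoeff_ne_zero.mpr hh)
      (pow_ne_zero _ (neg_ne_zero.mpr Complex.two_pi_I_ne_zero))
  refine ((tendsto_eval_modularJ_mul_nome a).div ((tendsto_eval_modularJ_mul_nome h).mul
    (tendsto_modularJ'_mul_nome.pow m)) hden).congr fun z => ?_
  have hq := nome_ne_zero z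
  have hexp : nome z ^ (-jComponentOrder a h m) =
      nome z ^ a.natDegree / (nome z ^ h.natDegree * nome z ^ m) := by
    rw [← pow_add, ← zpow_natCast, ← zpow_natCast, ← zpow_sub₀ hq, jComponentOrder]
    congr 1
    push_cast
    ring
  rw [hexp, jComponent, Pi.div_apply, Pi.mul_apply, mul_pow, div_mul_div_comm]
  congr 1
  ring

/-- If `w ↦ P (-1 / w)` does not grow exponentially, then no component of `P` does. -/
lemma jComponentOrder_nonneg {p : MvPolynomial (Fin 2) ℂ} {h : Polynomial ℂ} (hh : h ≠ 0)
    {ℓ : ℕ} {a : ℕ → Polynomial ℂ}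
    (ha : ∀ x y : ℂ, MvPolynomial.eval ![x, y] p =
      ∑ m ∈ Finset.range (ℓ + 1), (a m).eval x * y ^ (ℓ - m))
    (hgrowth : ¬ HasExpGrowthIn (jQuotient p h ℓ) ModularGroup.S)
    {m : ℕ} (hm : m ∈ Finset.range (ℓ + 1)) (ham : a m ≠ 0) :
    0 ≤ jComponentOrder (a m) h m := by
  classical
  by_contra hneg
  refine hgrowth (hasExpGrowthAtIInfty_of_sum (s := {m ∈ Finset.range (ℓ + 1) | a m ≠ 0})
    (F := fun m => jComponent (a m) h m) (e := fun m => jComponentOrder (a m) h m)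
    (α := fun m => jComponentCoeff (a m) h m)
    (fun k hk => jComponentCoeff_ne_zero (Finset.mem_filter.mp hk).2 hh k)
    (fun k _ => tendsto_jComponent_mul_nome (a k) hh k) ?_
    ⟨m, Finset.mem_filter.mpr ⟨hm, ham⟩, not_le.mp hneg⟩)
  filter_upwards [eventually_denominator_ne_zero_atImInfty hh ℓ] with w hw
  rw [jQuotient_smul_eq_sum ha hw, ModularGroup.denom_S, Finset.sum_filter_of_ne]
  intro k _ hk hak
  exact hk (by simp [jComponent, hak])

lemma exists_tendsto_jComponent_atImInfty {a h : Polynomial ℂ} (hh : h ≠ 0) {m : ℕ}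
    (horder : a ≠ 0 → 0 ≤ jComponentOrder a h m) :
    ∃ c, Tendsto (jComponent a h m) atImInfty (𝓝 c) := by
  by_cases ha : a = 0
  · refine ⟨0, tendsto_const_nhds.congr fun z => ?_⟩
    simp [jComponent, ha]
  · obtain ⟨k, hk⟩ := Int.eq_ofNat_of_zero_le (horder ha)
    refine ⟨_, ((tendsto_jComponent_mul_nome a hh m).mul (tendsto_nome.pow k)).congr fun z => ?_⟩
    rw [hk, zpow_neg, zpow_natCast, inv_mul_cancel_right₀ (pow_ne_zero _ (nome_ne_zero z))]

/-! ### Modular forms of non-positive weight -/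

/-- A component which is regular on `ℍ` and at the cusp is a modular form of weight `-2 m ≤ 0` and
level one, hence constant. -/
lemma jComponent_eq_const {a h : Polynomial ℂ} (hh : h ≠ 0) {m : ℕ}
    (hlim : ∀ τ : ℍ, ∃ c, Tendsto (jComponent a h m) (𝓝[≠] τ) (𝓝 c))
    (hcusp : ∃ c, Tendsto (jComponent a h m) atImInfty (𝓝 c)) :
    ∃ c, ∀ z : ℍ, h.eval (modularJ z) * modularJ' z ^ m ≠ 0 → jComponent a h m z = c := by
  obtain ⟨g, hg, hgF⟩ :=
    exists_mdifferentiable_eventuallyEq (meromorphicAt_jComponent a h m) hlim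
  have heq : ∀ z : ℍ, h.eval (modularJ z) * modularJ' z ^ m ≠ 0 → g z = jComponent a h m z :=
    fun z hz => eq_of_eventuallyEq_nhdsNE hg.continuous.continuousAt
      (continuousAt_jComponent hz) (hgF z)
  have hslash : ∀ γ : SL(2, ℤ), g ∣[-2 * (m : ℤ)] γ = g := by
    intro γ
    ext τ
    have hcont : Continuous fun z : ℍ => g (γ • z) * denom γ z ^ (2 * m) :=
      (hg.continuous.comp (continuous_const_smul (γ : GL (Fin 2) ℝ))).mul
        ((mdifferentiable_denom (γ : GL (Fin 2) ℝ)).continuous.pow _)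
    have hτ : g (γ • τ) * denom γ τ ^ (2 * m) = g τ := by
      refine eq_of_eventuallyEq_nhdsNE hcont.continuousAt hg.continuous.continuousAt ?_
      filter_upwards [hgF τ, (tendsto_smul_nhdsNE γ τ).eventually (hgF (γ • τ))] with z h1 h2
      have hd := denom_ne_zero (γ : GL (Fin 2) ℝ) z
      rw [h1, h2, jComponent_smul, pow_mul, inv_pow,
        inv_mul_cancel_right₀ (pow_ne_zero _ (pow_ne_zero _ hd))]
    rw [SL_slash_apply, ← hτ]
    congr 1
    rw [← zpow_natCast]
    congr 1
    push_cast
    ring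
  obtain ⟨c, hc⟩ := hcusp
  have hbdd : IsBoundedAtImInfty g := by
    refine (hc.congr' ?_).isBigO_one ℝ
    filter_upwards [eventually_denominator_ne_zero_atImInfty hh m] with z hz
    exact (heq z hz).symm
  let G : ModularForm 𝒮ℒ (-2 * (m : ℤ)) :=
    { toFun := g
      slash_action_eq' := fun _ ⟨γ, hγ⟩ => hγ ▸ hslash γ
      holo' := hg
      bdd_at_cusps' := fun {c} hc => by
        rw [Subgroup.IsArithmetic.isCusp_iff_isCusp_SL2Z] at hc
        rw [OnePoint.isBoundedAt_iff_forall_SL2Z hc]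
        intro γ _
        rwa [hslash γ] }
  have hconst : ∃ c, ∀ z, g z = c := by
    rcases Nat.eq_zero_or_pos m with rfl | hm
    · obtain ⟨c, hc⟩ := ModularFormClass.levelOne_weight_zero_const (F := ModularForm 𝒮ℒ 0) G
      exact ⟨c, fun z => congrFun hc z⟩
    · exact ⟨0, fun z => congrFun
        (ModularFormClass.levelOne_neg_weight_eq_zero (by omega : -2 * (m : ℤ) < 0) G) z⟩
  obtain ⟨c', hc'⟩ := hconst
  exact ⟨c', fun z hz => (heq z hz).symm.trans (hc' z)⟩

theorem corollary6p8 (p : MvPolynomial (Fin 2) ℂ) (h : Polynomial ℂ) (hh : h ≠ 0)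
    (ℓ : ℕ) (hl : MvPolynomial.degreeOf 1 p ≤ ℓ)
    (hP : ¬ ∃ c : ℂ, ∀ z : UpperHalfPlane, h.eval (modularJ z) * modularJ' z ^ ℓ ≠ 0 →
      jQuotient p h ℓ z = c) :
    HasPoleInH (jQuotient p h ℓ) ∨ ∃ γ : SL(2, ℤ), HasExpGrowthIn (jQuotient p h ℓ) γ := by
  by_contra! hcon
  obtain ⟨hpole, hgrowth⟩ := hcon
  obtain ⟨a, ha⟩ := exists_eval_eq_sum p hl
  have hconst : ∀ m ∈ Finset.range (ℓ + 1), ∃ c, ∀ z : ℍ,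
      h.eval (modularJ z) * modularJ' z ^ m ≠ 0 → jComponent (a m) h m z = c := fun m hm =>
    jComponent_eq_const hh (exists_tendsto_jComponent hh ha hpole hm)
      (exists_tendsto_jComponent_atImInfty hh
        (jComponentOrder_nonneg hh ha (hgrowth ModularGroup.S) hm))
  choose! c hc using hconst
  refine hP ⟨∑ m ∈ Finset.range (ℓ + 1), c m, fun z hz => ?_⟩
  rw [jQuotient_eq_sum ha hz]
  refine Finset.sum_congr rfl fun m hm => hc m hm z ?_
  -- For `m ≤ ℓ` the denominator of the component divides that of the quotient.
  rw [← Nat.add_sub_cancel' (Nat.lt_succ_iff.mp (Finset.mem_range.mp hm)), pow_add,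
    ← mul_assoc] at hz
  exact left_ne_zero_of_mul hz
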